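/- Let $n\ge 0$. Every Boolean function $f:\mathbb{Z}_2^n\to\mathbb{Z}_2$ is uniquely a sum of monomials $\prod_{i\in S}x_i$, $S\subseteq\{0,\dots,n-1\}$ (its algebraic normal form). Call $f$ *quadratic* if all monomials that occur have degree at most $2$; its graph is then the simple graph on $\{0,\dots,n-1\}$ in which $i\neq j$ are adjacent if and only if $x_ix_j$ occurs (linear and constant terms are ignored). For a simple graph $G$ on $\{0,\dots,n-1\}$ and a vertex $v$, local complementation at $v$ replaces the subgraph induced on the neighbourhood of $v$ by its complement and leaves all other adjacencies unchanged. The LC orbit $[G]$ is the set of all graphs on $\{0,\dots,n-1\}$ obtained from $G$ by finite sequences of local complementations and vertex permutations. Let $\alpha(K)$ be the largest size of an independent set of $K$, and let $\lambda(G)=\max_{K\in[G]}\alpha(K)$. Let $$I=\begin{pmatrix}1&0\\0&1\end{pmatrix},\quad H=\tfrac1{\sqrt2}\begin{pmatrix}1&1\\1&-1\end{pmatrix},\quad N=\tfrac1{\sqrt2}\begin{pmatrix}1&i\\1&-i\end{pmatrix},$$ and for a Boolean function $f$ of $n$ variables put $s=2^{-n/2}\bigl((-1)^{f(x)}\bigr)_{x\in\mathbb{Z}_2^n}$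 and $$\mathrm{PAR}_{IHN}(f)=2^n\max_{U,\,k}\bigl|(Us)_k\bigr|^2,$$ where $U$ runs over all $3^n$ tensor products $U_0\otimes\cdots\otimes U_{n-1}$ with $U_i\in\{I,H,N\}$, and $k$ over $\mathbb{Z}_2^n$. **Theorem.** Let $G$ be a simple graph on $\{0,\dots,n-1\}$. Then every quadratic Boolean function $f$ of $n$ variables whose graph lies in the LC orbit $[G]$ satisfies $\mathrm{PAR}_{IHN}(f)=2^{\lambda(G)}$. -/

import Mathlib

namespace BoolPAR

/-! ### Boolean functions, algebraic normal form, and the associated graph -/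

/-- The vector in `ℤ₂ⁿ` with support `T`. -/
def indVec {n : ℕ} (T : Finset (Fin n)) : Fin n → ZMod 2 :=
  fun i => if i ∈ T then 1 else 0

/-- The coefficient of the monomial `∏ i ∈ S, x i` in the algebraic normal form of `f`, obtained
from the truth table of `f` by the binary Möbius transform (see `eq_sum_anfCoeff`). -/
def anfCoeff {n : ℕ} (f : (Fin n → ZMod 2) → ZMod 2) (S : Finset (Fin n)) : ZMod 2 :=
  ∑ T ∈ S.powerset, f (indVec T)

theorem eq_sum_anfCoeff {n : ℕ} (f : (Fin n → ZMod 2) → ZMod 2) (x : Fin n → ZMod 2) :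
    f x = ∑ S : Finset (Fin n), anfCoeff f S * ∏ i ∈ S, x i := by
  obtain ⟨X, rfl⟩ : ∃ X : Finset (Fin n), x = indVec X := by
    refine ⟨Finset.univ.filter fun i => x i = 1, ?_⟩
    funext i
    have h : ∀ a : ZMod 2, a = if a = 1 then 1 else 0 := by decide
    simpa [indVec] using h (x i)
  have h1 : ∀ S : Finset (Fin n), ∏ i ∈ S, indVec X i = if S ⊆ X then 1 else 0 := by
    intro S
    split_ifs with h
    · exact Finset.prod_eq_one fun i hi => by simp [indVec, h hi]
    · obtain ⟨i, hi, hiX⟩ := Finset.not_subset.1 h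
      exact Finset.prod_eq_zero hi (by simp [indVec, hiX])
  have h2 : ∀ T : Finset (Fin n), T ∈ (Finset.univ : Finset (Finset (Fin n))) →
      (∑ S : Finset (Fin n), if T ⊆ S ∧ S ⊆ X then f (indVec T) else 0) =
        if T = X then f (indVec T) else 0 := by
    intro T _
    rw [← Finset.sum_filter]
    have h3 : (Finset.univ.filter fun S : Finset (Fin n) => T ⊆ S ∧ S ⊆ X) = Finset.Icc T X := by
      ext S; simp
    rw [h3, Finset.sum_const]
    by_cases hTX : T ⊆ X
    · rw [Finset.card_Icc_finset hTX]
      by_cases h : T = X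
      · simp [h]
      · have hlt : T.card < X.card :=
          Finset.card_lt_card (Finset.ssubset_iff_subset_ne.2 ⟨hTX, h⟩)
        obtain ⟨k, hk⟩ : ∃ k, X.card - T.card = k + 1 := ⟨X.card - T.card - 1, by omega⟩
        have h20 : (2 : ZMod 2) = 0 := by decide
        simp [h, hk, pow_succ, h20]
    · have h : T ≠ X := fun h => hTX h.subset
      simp [h, Finset.Icc_eq_empty (a := T) (b := X) hTX]
  calc f (indVec X) = ∑ T : Finset (Fin n), if T = X then f (indVec T) else 0 := by simp
    _ = ∑ T : Finset (Fin n), ∑ S : Finset (Fin n),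
          if T ⊆ S ∧ S ⊆ X then f (indVec T) else 0 := (Finset.sum_congr rfl h2).symm
    _ = ∑ S : Finset (Fin n), anfCoeff f S * ∏ i ∈ S, indVec X i := by
        rw [Finset.sum_comm]
        refine Finset.sum_congr rfl fun S _ => ?_
        rw [h1, anfCoeff, mul_ite, mul_one, mul_zero]
        by_cases hS : S ⊆ X
        · simp only [hS, and_true, if_true]
          rw [← Finset.sum_filter]
          refine Finset.sum_congr ?_ fun _ _ => rfl
          ext T; simp
        · simp [hS]

/-- A Boolean function is quadratic if its algebraic normal form has no monomial of degree
greater than two. -/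
def IsQuadratic {n : ℕ} (f : (Fin n → ZMod 2) → ZMod 2) : Prop :=
  ∀ S : Finset (Fin n), 2 < S.card → anfCoeff f S = 0

/-- The simple graph of a quadratic Boolean function: `i` and `j` are adjacent iff the monomial
`x i * x j` occurs in the algebraic normal form. Linear and constant terms are ignored. -/
def graphOf {n : ℕ} (f : (Fin n → ZMod 2) → ZMod 2) : SimpleGraph (Fin n) where
  Adj i j := i ≠ j ∧ anfCoeff f {i, j} ≠ 0
  symm := ⟨fun i j h => ⟨h.1.symm, by rw [Finset.pair_comm]; exact h.2⟩⟩
  loopless := ⟨fun _ h => h.1 rfl⟩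

/-! ### Local complementation and the LC orbit -/

/-- Local complementation at `v`: the subgraph induced on the neighbourhood of `v` is replaced by
its complement, all other adjacencies are kept. -/
def localComp {V : Type*} (G : SimpleGraph V) (v : V) : SimpleGraph V where
  Adj i j := i ≠ j ∧ Xor (G.Adj i j) (G.Adj v i ∧ G.Adj v j)
  symm := ⟨fun i j h => ⟨h.1.symm, by rw [G.adj_comm j i, and_comm]; exact h.2⟩⟩
  loopless := ⟨fun _ h => h.1 rfl⟩

/-- One step: a local complementation or a permutation of the vertices. -/
def LCStep {V : Type*} (G K : SimpleGraph V) : Prop :=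
  (∃ v, K = localComp G v) ∨ ∃ π : Equiv.Perm V, K = G.map π.toEmbedding

/-- The LC orbit `[G]`: all graphs obtained from `G` by a finite sequence of local
complementations and vertex permutations. -/
def lcOrbit {V : Type*} (G : SimpleGraph V) : Set (SimpleGraph V) :=
  {K | Relation.ReflTransGen LCStep G K}

/-- `λ(G)`: the largest independence number of a graph in the LC orbit of `G`. -/
noncomputable def lam {n : ℕ} (G : SimpleGraph (Fin n)) : ℕ :=
  sSup {a | ∃ K ∈ lcOrbit G, a = K.indepNum}

/-! ### Transforms and the peak-to-average power ratio -/

/-- The Hadamard matrix. -/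
noncomputable def hadamard : Matrix (ZMod 2) (ZMod 2) ℂ :=
  ((Real.sqrt 2 : ℝ) : ℂ)⁻¹ • (!![1, 1; 1, -1] : Matrix (Fin 2) (Fin 2) ℂ)

/-- The negahadamard matrix. -/
noncomputable def negahadamard : Matrix (ZMod 2) (ZMod 2) ℂ :=
  ((Real.sqrt 2 : ℝ) : ℂ)⁻¹ • (!![1, Complex.I; 1, -Complex.I] : Matrix (Fin 2) (Fin 2) ℂ)

/-- The transform set `{I, H, N}`. -/
noncomputable def transIHN : Fin 3 → Matrix (ZMod 2) (ZMod 2) ℂ :=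
  ![1, hadamard, negahadamard]

/-- The tensor product `U 0 ⊗ ⋯ ⊗ U (n-1)`, acting on vectors indexed by `ℤ₂ⁿ`. -/
def tensor {n : ℕ} (U : Fin n → Matrix (ZMod 2) (ZMod 2) ℂ) :
    Matrix (Fin n → ZMod 2) (Fin n → ZMod 2) ℂ :=
  Matrix.of fun k x => ∏ i, U i (k i) (x i)

/-- The peak-to-average power ratio of the vector `s` of length `2ⁿ` with respect to the transform
set `{T j | j ∈ ι}ⁿ`. -/
noncomputable def PAR {ι : Type*} [Fintype ι] [Nonempty ι] {n : ℕ}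
    (T : ι → Matrix (ZMod 2) (ZMod 2) ℂ) (s : (Fin n → ZMod 2) → ℂ) : ℝ :=
  2 ^ n * (Finset.univ : Finset ((Fin n → ι) × (Fin n → ZMod 2))).sup' Finset.univ_nonempty
    fun p => ‖(tensor (fun i => T (p.1 i))).mulVec s p.2‖ ^ 2

/-- The normalised bipolar vector `s = 2^{-n/2} (-1)^{f(x)}` of a Boolean function `f`. -/
noncomputable def stateVec {n : ℕ} (f : (Fin n → ZMod 2) → ZMod 2) : (Fin n → ZMod 2) → ℂ :=
  fun x => (((Real.sqrt 2 : ℝ) : ℂ) ^ n)⁻¹ * (-1) ^ (f x).val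

/-- The `PAR` of a Boolean function with respect to the `{I, H, N}ⁿ` transform. -/
noncomputable def parIHN {n : ℕ} (f : (Fin n → ZMod 2) → ZMod 2) : ℝ :=
  PAR transIHN (stateVec f)

end BoolPAR

namespace BoolPAR

open Finset

/-! ### Quadratic exponential sums -/

/-! For a transform `u` and a row `k`, write `R` for the positions where the factor is not `I`. Up
to a scalar, the entry of the transformed vector is an exponential sum of `i ^ q(T)` over `T ⊆ R`,
where `q` is a quadratic form with symmetric integer matrix. Modulo 2 the off-diagonal part of this
matrix is the graph of `f`. The choice of `H` or `N` and of `k` makes the diagonal on `R` arbitrary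
modulo 4, so the values of `2 ^ n |(U s)_k| ^ 2` are exactly the numbers `r` with `Attains (graphOf
f) r`.

Summing over the variable of one vertex `v` gives the factor `1 + i ^ (2w + c)`, where `c` is the
diagonal entry and `w` the row sum. If `c` is odd, this is a constant times `i ^ (-c w ^ 2)`: `v`
disappears and an odd multiple of the squared row is added, which is a local complementation at `v`.
If `c` is even, the factor vanishes unless `w` has one fixed parity, and adding the squared row
changes only a global phase. Hence `Attains` is constant on the LC orbit.

An independent set of size `a` in any graph of the orbit attains `2 ^ a`. Conversely, eliminating
vertices of odd diagonal, creating them along edges when all diagonals are even, ends at an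
independent set, where the trivial bound is `2 ^ #R`. -/

/-- The value at the indicator vector of `T` of the quadratic form with matrix `A`. -/
def quadForm {V : Type*} (A : V → V → ℤ) (T : Finset V) : ℤ :=
  ∑ i ∈ T, ∑ j ∈ T, A i j

/-- The exponential sum of the quadratic form `A` over the subsets of `R`. -/
noncomputable def expSum {V : Type*} (A : V → V → ℤ) (R : Finset V) : ℂ :=
  ∑ T ∈ R.powerset, Complex.I ^ quadForm A T

/-- The normalised power of the exponential sum `expSum A R`. -/
noncomputable def power {V : Type*} (A : V → V → ℤ) (R : Finset V) : ℝ :=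
  ‖expSum A R‖ ^ 2 / 2 ^ #R

/-- The integer matrix `A` is symmetric and its off-diagonal part reduces modulo two to the
adjacency matrix of `G`. -/
structure Realizes {V : Type*} (A : V → V → ℤ) (G : SimpleGraph V) : Prop where
  symm : ∀ i j, A i j = A j i
  odd_iff : ∀ i j, i ≠ j → (Odd (A i j) ↔ G.Adj i j)

/-- The row of `A` at `v`, with the diagonal entry replaced by zero. -/
def offDiagRow {V : Type*} [DecidableEq V] (A : V → V → ℤ) (v j : V) : ℤ :=
  if j = v then 0 else A v j

section

variable {V : Type*} [DecidableEq V]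

theorem quadForm_insert {A : V → V → ℤ} (hA : ∀ i j, A i j = A j i) {v : V} {T : Finset V}
    (hv : v ∉ T) :
    quadForm A (insert v T) = quadForm A T + 2 * ∑ j ∈ T, A v j + A v v := by
  have h : ∑ i ∈ T, A i v = ∑ j ∈ T, A v j := sum_congr rfl fun i _ => hA i v
  simp only [quadForm, sum_insert hv, sum_add_distrib, h]
  ring

theorem quadForm_add_mul {W : Type*} (A : W → W → ℤ) (b : W → ℤ) (t : ℤ) (T : Finset W) :
    quadForm (fun i j => A i j + t * (b i * b j)) T = quadForm A T + t * (∑ j ∈ T, b j) ^ 2 := by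
  rw [sq, sum_mul_sum]
  simp only [quadForm, sum_add_distrib, mul_sum]

theorem sum_offDiagRow (A : V → V → ℤ) {v : V} {T : Finset V} (hv : v ∉ T) :
    ∑ j ∈ T, offDiagRow A v j = ∑ j ∈ T, A v j :=
  sum_congr rfl fun j hj => if_neg fun h : j = v => hv (h ▸ hj)

theorem sum_offDiagRow_insert (A : V → V → ℤ) {v : V} {T : Finset V} (hv : v ∉ T) :
    ∑ j ∈ insert v T, offDiagRow A v j = ∑ j ∈ T, A v j := by
  rw [sum_insert hv, sum_offDiagRow A hv, offDiagRow, if_pos rfl, zero_add]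

/-- Changing `A` by an odd multiple of the square of its row at `v` performs a local
complementation at `v`. -/
theorem Realizes.localComp {A : V → V → ℤ} {G : SimpleGraph V} (hA : Realizes A G) (v : V)
    {t : ℤ} (ht : Odd t) :
    Realizes (fun i j => A i j + t * (offDiagRow A v i * offDiagRow A v j))
      (localComp G v) where
  symm i j := by rw [hA.symm i j, mul_comm (offDiagRow A v i)]
  odd_iff i j hij := by
    have hrow : ∀ k, Odd (offDiagRow A v k) ↔ G.Adj v k := by
      intro k
      by_cases h : k = v
      · subst h; simp [offDiagRow]
      · rw [offDiagRow, if_neg h, hA.odd_iff v k (Ne.symm h)]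
    have hxor : ∀ p q : Prop, (p ↔ ¬ q) ↔ Xor p q := by
      intro p q; unfold Xor; tauto
    rw [Int.odd_add, ← Int.not_odd_iff_even, Int.odd_mul, Int.odd_mul, hrow, hrow,
      hA.odd_iff i j hij, hxor]
    simp [BoolPAR.localComp, ht, hij]

/-! ### Powers of `i` modulo 4. -/

theorem I_zpow_four_mul (m : ℤ) : Complex.I ^ (4 * m) = 1 := by
  rw [zpow_mul]
  have : Complex.I ^ (4 : ℤ) = 1 := by
    exact_mod_cast Complex.I_pow_four
  rw [this, one_zpow]

theorem I_zpow_congr {a b : ℤ} (h : a ≡ b [ZMOD 4]) : Complex.I ^ a = Complex.I ^ b := by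
  obtain ⟨m, hm⟩ := h.symm.dvd
  rw [show a = b + 4 * m by linarith, zpow_add₀ Complex.I_ne_zero, I_zpow_four_mul, mul_one]

theorem I_zpow_sum {ι : Type*} (T : Finset ι) (c : ι → ℤ) :
    Complex.I ^ (∑ i ∈ T, c i) = ∏ i ∈ T, Complex.I ^ c i := by
  classical
  induction T using Finset.induction_on with
  | empty => simp
  | insert v T hv ih => rw [sum_insert hv, prod_insert hv, zpow_add₀ Complex.I_ne_zero, ih]

theorem norm_I_zpow (m : ℤ) : ‖Complex.I ^ m‖ = 1 := by
  rw [norm_zpow, Complex.norm_I, one_zpow]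

theorem I_zpow_two : Complex.I ^ (2 : ℤ) = -1 := by
  exact_mod_cast Complex.I_sq

theorem I_zpow_three : Complex.I ^ (3 : ℤ) = -Complex.I := by
  exact_mod_cast Complex.I_pow_three

theorem sq_modEq_four (w : ℤ) :
    (w % 2 = 0 ∧ w ^ 2 ≡ 0 [ZMOD 4]) ∨ (w % 2 = 1 ∧ w ^ 2 ≡ 1 [ZMOD 4]) := by
  rcases Int.even_or_odd' w with ⟨k, rfl | rfl⟩
  · left
    exact ⟨by omega, (Int.modEq_iff_dvd.2 ⟨-k ^ 2, by ring⟩)⟩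
  · right
    exact ⟨by omega, (Int.modEq_iff_dvd.2 ⟨-k ^ 2 - k, by ring⟩)⟩

/-- The factor is `1 + i` or `1 - i` according to the parity of `w`; their ratio is a power of `i`,
and `w ^ 2` modulo 4 records that parity. -/
theorem one_add_I_zpow_of_odd {c : ℤ} (hc : Odd c) (w : ℤ) :
    1 + Complex.I ^ (2 * w + c) = (1 + Complex.I ^ c) * Complex.I ^ (-c * w ^ 2) := by
  have hc4 : c ≡ 1 [ZMOD 4] ∨ c ≡ 3 [ZMOD 4] := by
    rw [Int.odd_iff] at hc
    unfold Int.ModEq; omega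
  rcases hc4 with h1 | h1 <;> rcases sq_modEq_four w with ⟨h2, h3⟩ | ⟨h2, h3⟩
  · have e1 : 2 * w + c ≡ 1 [ZMOD 4] := by unfold Int.ModEq at *; omega
    have e2 : -c * w ^ 2 ≡ 0 [ZMOD 4] := by simpa using (h1.neg.mul h3)
    rw [I_zpow_congr e1, I_zpow_congr e2, I_zpow_congr h1]; simp
  · have e1 : 2 * w + c ≡ 3 [ZMOD 4] := by unfold Int.ModEq at *; omega
    have e2 : -c * w ^ 2 ≡ 3 [ZMOD 4] := (h1.neg.mul h3).trans (by decide)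
    rw [I_zpow_congr e1, I_zpow_congr e2, I_zpow_congr h1, I_zpow_three, zpow_one]
    linear_combination Complex.I_sq
  · have e1 : 2 * w + c ≡ 3 [ZMOD 4] := by unfold Int.ModEq at *; omega
    have e2 : -c * w ^ 2 ≡ 0 [ZMOD 4] := by simpa using (h1.neg.mul h3)
    rw [I_zpow_congr e1, I_zpow_congr e2, I_zpow_congr h1]; simp
  · have e1 : 2 * w + c ≡ 1 [ZMOD 4] := by unfold Int.ModEq at *; omega
    have e2 : -c * w ^ 2 ≡ 1 [ZMOD 4] := (h1.neg.mul h3).trans (by decide)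
    rw [I_zpow_congr e1, I_zpow_congr e2, I_zpow_congr h1, I_zpow_three, zpow_one]
    linear_combination Complex.I_sq

/-- The factor is zero for one parity of `w`; on the other, `i ^ w ^ 2` is constant. -/
theorem exists_phase_of_even {c : ℤ} (hc : Even c) :
    ∃ m : ℤ, ∀ w : ℤ, (1 + Complex.I ^ (2 * w + c)) * Complex.I ^ w ^ 2 =
      (1 + Complex.I ^ (2 * w + c)) * Complex.I ^ m := by
  have hc4 : c ≡ 0 [ZMOD 4] ∨ c ≡ 2 [ZMOD 4] := by
    rw [Int.even_iff] at hc
    unfold Int.ModEq; omega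
  rcases hc4 with h1 | h1
  · refine ⟨0, fun w => ?_⟩
    rcases sq_modEq_four w with ⟨h2, h3⟩ | ⟨h2, h3⟩
    · rw [I_zpow_congr h3]
    · have e1 : 2 * w + c ≡ 2 [ZMOD 4] := by unfold Int.ModEq at *; omega
      rw [I_zpow_congr e1, I_zpow_two]; simp
  · refine ⟨1, fun w => ?_⟩
    rcases sq_modEq_four w with ⟨h2, h3⟩ | ⟨h2, h3⟩
    · have e1 : 2 * w + c ≡ 2 [ZMOD 4] := by unfold Int.ModEq at *; omega
      rw [I_zpow_congr e1, I_zpow_two]; simp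
    · rw [I_zpow_congr h3]

/-! ### Summing out one vertex. -/

theorem expSum_insert {A : V → V → ℤ} (hA : ∀ i j, A i j = A j i) {v : V} {R : Finset V}
    (hv : v ∉ R) :
    expSum A (insert v R) = ∑ T ∈ R.powerset,
      (1 + Complex.I ^ (2 * ∑ j ∈ T, A v j + A v v)) * Complex.I ^ quadForm A T := by
  rw [expSum, sum_powerset_insert hv, ← sum_add_distrib]
  refine sum_congr rfl fun T hT => ?_
  rw [quadForm_insert hA fun h => hv (mem_powerset.1 hT h), add_assoc,
    zpow_add₀ Complex.I_ne_zero]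
  ring

theorem norm_one_add_I_zpow_sq {c : ℤ} (hc : Odd c) : ‖1 + Complex.I ^ c‖ ^ 2 = 2 := by
  have hc4 : c ≡ 1 [ZMOD 4] ∨ c ≡ 3 [ZMOD 4] := by
    rw [Int.odd_iff] at hc
    unfold Int.ModEq; omega
  rw [← Complex.normSq_eq_norm_sq]
  rcases hc4 with h | h
  · rw [I_zpow_congr h, zpow_one, Complex.normSq_apply]; norm_num
  · rw [I_zpow_congr h, I_zpow_three, Complex.normSq_apply]; norm_num

/-- Summing out a vertex with odd diagonal entry. -/
theorem power_insert_of_odd {A : V → V → ℤ} (hA : ∀ i j, A i j = A j i) {v : V} {R : Finset V}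
    (hv : v ∉ R) (hc : Odd (A v v)) :
    power A (insert v R) =
      power (fun i j => A i j + -A v v * (offDiagRow A v i * offDiagRow A v j)) R := by
  have h : expSum A (insert v R) = (1 + Complex.I ^ A v v) *
      expSum (fun i j => A i j + -A v v * (offDiagRow A v i * offDiagRow A v j)) R := by
    rw [expSum_insert hA hv, expSum, mul_sum]
    refine sum_congr rfl fun T hT => ?_
    rw [one_add_I_zpow_of_odd hc, quadForm_add_mul,
      sum_offDiagRow A fun h => hv (mem_powerset.1 hT h), zpow_add₀ Complex.I_ne_zero]
    ring
  rw [power, power, h, norm_mul, mul_pow, norm_one_add_I_zpow_sq hc, card_insert_of_notMem hv,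
    pow_succ' (2 : ℝ), mul_div_mul_left _ _ two_ne_zero]

/-- At a vertex with even diagonal entry, a local complementation does not change the power. -/
theorem power_insert_of_even {A : V → V → ℤ} (hA : ∀ i j, A i j = A j i) {v : V} {R : Finset V}
    (hv : v ∉ R) (hc : Even (A v v)) :
    power A (insert v R) =
      power (fun i j => A i j + 1 * (offDiagRow A v i * offDiagRow A v j)) (insert v R) := by
  obtain ⟨m, hm⟩ := exists_phase_of_even hc
  have h : expSum (fun i j => A i j + 1 * (offDiagRow A v i * offDiagRow A v j)) (insert v R) =
      Complex.I ^ m * expSum A (insert v R) := by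
    rw [expSum_insert hA hv, mul_sum, expSum, sum_powerset_insert hv, ← sum_add_distrib]
    refine sum_congr rfl fun T hT => ?_
    have hvT : v ∉ T := fun h => hv (mem_powerset.1 hT h)
    rw [quadForm_add_mul, quadForm_add_mul, sum_offDiagRow A hvT, sum_offDiagRow_insert A hvT,
      quadForm_insert hA hvT, one_mul, ← mul_assoc, mul_comm (Complex.I ^ m), ← hm,
      add_assoc (quadForm A T)]
    simp only [zpow_add₀ Complex.I_ne_zero]
    ring
  rw [power, power, h, norm_mul, norm_I_zpow, one_mul]

/-- Each off-diagonal entry is counted twice in the form, so modulo 2 suffices there while the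
diagonal matters modulo 4. -/
theorem power_congr {A B : V → V → ℤ} (hA : ∀ i j, A i j = A j i) (hB : ∀ i j, B i j = B j i)
    {R : Finset V} (hd : ∀ i ∈ R, A i i ≡ B i i [ZMOD 4])
    (ho : ∀ i ∈ R, ∀ j ∈ R, i ≠ j → A i j ≡ B i j [ZMOD 2]) : power A R = power B R := by
  have h : ∀ T : Finset V, T ⊆ R → quadForm A T ≡ quadForm B T [ZMOD 4] := by
    intro T
    induction T using Finset.induction_on with
    | empty => intro _; simp [quadForm]
    | insert v T hv ih =>
      intro hT
      have hvR : v ∈ R := hT (mem_insert_self v T)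
      have hTR : T ⊆ R := (subset_insert v T).trans hT
      rw [quadForm_insert hA hv, quadForm_insert hB hv]
      refine Int.ModEq.add (Int.ModEq.add (ih hTR) ?_) (hd v hvR)
      have hs : ∑ j ∈ T, A v j ≡ ∑ j ∈ T, B v j [ZMOD 2] :=
        Int.ModEq.sum fun j hj => ho v hvR j (hTR hj) fun h => hv (h ▸ hj)
      exact Int.ModEq.mul_left' hs
  rw [power, power, expSum, expSum,
    sum_congr rfl fun T hT => I_zpow_congr (h T (mem_powerset.1 hT))]

/-! ### Invariance under local complementation and permutations -/

/-- `r` is the power of an exponential sum belonging to `G`. -/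
def Attains {W : Type*} (G : SimpleGraph W) (r : ℝ) : Prop :=
  ∃ (A : W → W → ℤ) (R : Finset W), Realizes A G ∧ power A R = r

theorem Attains.localComp {G : SimpleGraph V} {r : ℝ} (h : Attains G r) (v : V) :
    Attains (localComp G v) r := by
  obtain ⟨A, R, hA, rfl⟩ := h
  by_cases hv : v ∈ R
  · rw [← insert_erase hv]
    rcases Int.even_or_odd (A v v) with hc | hc
    · exact ⟨_, _, hA.localComp v odd_one, (power_insert_of_even hA.symm (notMem_erase v R) hc).symm⟩
    · exact ⟨_, _, hA.localComp v hc.neg, (power_insert_of_odd hA.symm (notMem_erase v R) hc).symm⟩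
  · have hB := hA.localComp v odd_one
    -- For `v ∉ R` the odd elimination is run backwards: `v` joins the set with diagonal entry 1,
    -- and summing it out subtracts the squared row that was added.
    let C : V → V → ℤ := fun i j => if i = v ∧ j = v then 1 else
      A i j + 1 * (offDiagRow A v i * offDiagRow A v j)
    have hC : Realizes C (BoolPAR.localComp G v) := by
      refine ⟨fun i j => ?_, fun i j hij => ?_⟩
      · simp only [C, and_comm (a := i = v)]
        rw [hB.symm i j]
      · have : ¬ (i = v ∧ j = v) := fun h => hij (h.1.trans h.2.symm)
        simp only [C, if_neg this]
        exact hB.odd_iff i j hij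
    have hCv : C v v = 1 := by simp [C]
    have hrow : offDiagRow C v = offDiagRow A v := by
      funext j
      by_cases hj : j = v <;> simp [offDiagRow, C, hj]
    refine ⟨C, insert v R, hC, ?_⟩
    rw [power_insert_of_odd hC.symm hv (by rw [hCv]; exact odd_one), hrow, hCv]
    have key : ∀ i ∈ R, ∀ j ∈ R,
        C i j + -1 * (offDiagRow A v i * offDiagRow A v j) = A i j := by
      intro i hi j _
      have : ¬ (i = v ∧ j = v) := fun h => hv (h.1 ▸ hi)
      simp only [C, if_neg this]
      ring
    refine power_congr (fun i j => ?_) hA.symm (fun i hi => ?_) fun i hi j hj _ => ?_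
    · rw [hC.symm i j, mul_comm (offDiagRow A v i)]
    · rw [key i hi i hi]
    · rw [key i hi j hj]

theorem power_map {U W : Type*} (A : W → W → ℤ) (e : U ≃ W) (R : Finset U) :
    power A (R.map e.toEmbedding) = power (fun i j => A (e i) (e j)) R := by
  have h : expSum A (R.map e.toEmbedding) = expSum (fun i j => A (e i) (e j)) R := by
    unfold expSum
    refine (sum_equiv e.finsetCongr (fun T => ?_) fun T _ => ?_).symm
    · simp
    · simp [quadForm]
  rw [power, power, h, card_map]

theorem Attains.map {W : Type*} {G : SimpleGraph W} {r : ℝ} (h : Attains G r)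
    (e : Equiv.Perm W) :
    Attains (G.map e.toEmbedding) r := by
  obtain ⟨A, R, hA, rfl⟩ := h
  refine ⟨fun i j => A (e.symm i) (e.symm j), R.map e.toEmbedding,
    ⟨fun i j => hA.symm _ _, fun i j hij => ?_⟩, ?_⟩
  · rw [hA.odd_iff _ _ (e.symm.injective.ne hij)]
    rw [← SimpleGraph.map_adj_apply (f := e.toEmbedding)]
    simp
  · rw [power_map]; simp

/-- The neighbourhood of `v` itself is unchanged, so the same pairs are flipped twice. -/
theorem localComp_localComp {W : Type*} (G : SimpleGraph W) (v : W) :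
    localComp (localComp G v) v = G := by
  ext i j
  have h : ∀ k, (localComp G v).Adj v k ↔ G.Adj v k := by
    intro k
    simp only [localComp, Xor, SimpleGraph.irrefl, false_and, not_false_eq_true, and_true, or_false]
    exact ⟨fun h => by tauto, fun h => ⟨h.ne, by tauto⟩⟩
  have hne : G.Adj i j → i ≠ j := fun h => h.ne
  change (i ≠ j ∧ Xor ((localComp G v).Adj i j) ((localComp G v).Adj v i ∧ (localComp G v).Adj v j))
    ↔ _
  rw [h, h]
  change (i ≠ j ∧ Xor (i ≠ j ∧ Xor (G.Adj i j) (G.Adj v i ∧ G.Adj v j)) _) ↔ _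
  unfold Xor
  tauto

theorem LCStep.symm {W : Type*} {G K : SimpleGraph W} (h : LCStep G K) : LCStep K G := by
  rcases h with ⟨v, rfl⟩ | ⟨π, rfl⟩
  · exact Or.inl ⟨v, (localComp_localComp G v).symm⟩
  · refine Or.inr ⟨π.symm, ?_⟩
    rw [SimpleGraph.map_map]
    have : ⇑π.symm.toEmbedding ∘ ⇑π.toEmbedding = id := by
      ext; simp
    rw [this, SimpleGraph.map_id]

theorem attains_iff_of_mem_lcOrbit {G K : SimpleGraph V} (h : K ∈ lcOrbit G) (r : ℝ) :
    Attains K r ↔ Attains G r := by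
  have step : ∀ {G K : SimpleGraph V}, LCStep G K → Attains G r → Attains K r := by
    rintro G K (⟨v, rfl⟩ | ⟨π, rfl⟩) h
    · exact h.localComp v
    · exact h.map π
  induction (show Relation.ReflTransGen LCStep G K from h) with
  | refl => rfl
  | tail hGK hs ih => exact ⟨fun h => (ih hGK).1 (step hs.symm h), fun h => step hs ((ih hGK).2 h)⟩

/-! ### Comparison with independent sets -/

theorem localComp_mem_lcOrbit {W : Type*} (G : SimpleGraph W) (v : W) :
    localComp G v ∈ lcOrbit G :=
  Relation.ReflTransGen.single (Or.inl ⟨v, rfl⟩)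

theorem lcOrbit_trans {W : Type*} {G K L : SimpleGraph W} (h : K ∈ lcOrbit G)
    (h' : L ∈ lcOrbit K) : L ∈ lcOrbit G :=
  Relation.ReflTransGen.trans h h'

theorem norm_expSum_le {W : Type*} (A : W → W → ℤ) (R : Finset W) : ‖expSum A R‖ ≤ 2 ^ #R := by
  refine (norm_sum_le _ _).trans ?_
  simp [card_powerset]

theorem power_le {W : Type*} (A : W → W → ℤ) (R : Finset W) : power A R ≤ 2 ^ #R := by
  rw [power, div_le_iff₀ (by positivity), ← sq]
  exact pow_le_pow_left₀ (norm_nonneg _) (norm_expSum_le A R) 2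

/-- Induction on `#R`, with the graph and the matrix left free because each elimination changes
both. -/
theorem exists_power_le_of_realizes [Fintype V] (R : Finset V) :
    ∀ (G : SimpleGraph V) (A : V → V → ℤ), Realizes A G →
      ∃ K ∈ lcOrbit G, power A R ≤ 2 ^ K.indepNum := by
  induction hn : #R generalizing R with
  | zero =>
    intro G A _
    refine ⟨G, Relation.ReflTransGen.refl, (power_le A R).trans ?_⟩
    rw [hn]
    exact pow_le_pow_right₀ one_le_two (Nat.zero_le _)
  | succ m ih =>
    intro G A hA
    have odd_case : ∀ (G : SimpleGraph V) (A : V → V → ℤ), Realizes A G → ∀ v ∈ R, Odd (A v v) →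
        ∃ K ∈ lcOrbit G, power A R ≤ 2 ^ K.indepNum := by
      intro G A hA v hv hc
      obtain ⟨K, hK, hle⟩ := ih (R.erase v) (by rw [card_erase_of_mem hv, hn]; rfl) _ _
        (hA.localComp v hc.neg)
      refine ⟨K, lcOrbit_trans (localComp_mem_lcOrbit G v) hK, ?_⟩
      rwa [← power_insert_of_odd hA.symm (notMem_erase v R) hc, insert_erase hv] at hle
    by_cases hodd : ∃ v ∈ R, Odd (A v v)
    · obtain ⟨v, hv, hc⟩ := hodd
      exact odd_case G A hA v hv hc
    push Not at hodd
    by_cases hind : G.IsIndepSet R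
    · exact ⟨G, Relation.ReflTransGen.refl, (power_le A R).trans
        (pow_le_pow_right₀ one_le_two hind.card_le_indepNum)⟩
    · obtain ⟨v, hv, w, hw, hvw, hadj⟩ : ∃ v ∈ R, ∃ w ∈ R, v ≠ w ∧ G.Adj v w := by
        by_contra hcon
        push Not at hcon
        exact hind fun v hv w hw hvw => hcon v hv w hw hvw
      have hcv := Int.not_odd_iff_even.1 (hodd v hv)
      have hcw := Int.not_odd_iff_even.1 (hodd w hw)
      -- Complementing at `v` adds the odd square `A v w ^ 2` to the even diagonal entry at its
      -- neighbour `w`, making `w` eliminable.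
      obtain ⟨K, hK, hle⟩ := odd_case _ _ (hA.localComp v odd_one) w hw (by
        have : Odd (A v w) := (hA.odd_iff v w hvw).2 hadj
        rw [offDiagRow, if_neg hvw.symm, one_mul]
        exact hcw.add_odd (this.mul this))
      refine ⟨K, lcOrbit_trans (localComp_mem_lcOrbit G v) hK, ?_⟩
      rw [← insert_erase hv] at hle ⊢
      rwa [← power_insert_of_even hA.symm (notMem_erase v R) hcv] at hle

/-- The 0/1 adjacency matrix vanishes on `R`, so every term of the sum is 1. -/
theorem attains_of_isIndepSet {W : Type*} {G : SimpleGraph W} {R : Finset W} (h : G.IsIndepSet R) :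
    Attains G (2 ^ #R) := by
  classical
  let A : W → W → ℤ := fun i j => if G.Adj i j then 1 else 0
  have hA : Realizes A G := by
    refine ⟨fun i j => by simp only [A, G.adj_comm i j], fun i j _ => ?_⟩
    by_cases hij : G.Adj i j <;> simp [A, hij]
  refine ⟨A, R, hA, ?_⟩
  have hq : ∀ T ∈ R.powerset, Complex.I ^ quadForm A T = 1 := by
    intro T hT
    rw [mem_powerset] at hT
    have : quadForm A T = 0 := by
      refine sum_eq_zero fun i hi => sum_eq_zero fun j hj => if_neg fun hadj => ?_
      exact h (hT hi) (hT hj) hadj.ne hadj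
    rw [this, zpow_zero]
  rw [power, expSum, sum_congr rfl hq]
  simp [card_powerset, sq]

end

/-! ### Quadratic Boolean functions as quadratic forms modulo four -/

/-- The matrix of the quadratic form modulo four that represents a quadratic Boolean function
up to its constant term. -/
def anfMatrix {n : ℕ} (f : (Fin n → ZMod 2) → ZMod 2) (i j : Fin n) : ℤ :=
  if i = j then 2 * ((anfCoeff f {i}).val : ℤ) else ((anfCoeff f {i, j}).val : ℤ)

theorem anfMatrix_symm {n : ℕ} (f : (Fin n → ZMod 2) → ZMod 2) (i j : Fin n) :
    anfMatrix f i j = anfMatrix f j i := by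
  by_cases h : i = j
  · rw [h]
  · rw [anfMatrix, anfMatrix, if_neg h, if_neg (Ne.symm h), pair_comm]

theorem realizes_anfMatrix {n : ℕ} (f : (Fin n → ZMod 2) → ZMod 2) :
    Realizes (anfMatrix f) (graphOf f) := by
  refine ⟨anfMatrix_symm f, fun i j hij => ?_⟩
  have h : ∀ a : ZMod 2, Odd (a.val : ℤ) ↔ a ≠ 0 := by decide
  rw [anfMatrix, if_neg hij, h]
  exact ⟨fun h => ⟨hij, h⟩, fun h => h.2⟩

theorem apply_indVec {n : ℕ} (f : (Fin n → ZMod 2) → ZMod 2) (T : Finset (Fin n)) :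
    f (indVec T) = ∑ S ∈ T.powerset, anfCoeff f S := by
  rw [eq_sum_anfCoeff f]
  have h1 : ∀ S : Finset (Fin n), anfCoeff f S * ∏ i ∈ S, indVec T i =
      if S ∈ T.powerset then anfCoeff f S else 0 := by
    intro S
    split_ifs with h
    · rw [mem_powerset] at h
      rw [prod_eq_one fun i hi => by simp [indVec, h hi], mul_one]
    · rw [mem_powerset] at h
      obtain ⟨i, hi, hiT⟩ := not_subset.1 h
      rw [prod_eq_zero hi (by simp [indVec, hiT]), mul_zero]
  rw [sum_congr rfl fun S _ => h1 S, sum_ite_mem, univ_inter]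

/-- Used with `g S = anfCoeff f (insert v S)`: the difference of a quadratic `f` in direction `v` is
affine. -/
theorem sum_powerset_eq_add_sum_singleton {α M : Type*} [DecidableEq α] [AddCommMonoid M]
    (g : Finset α → M) (T : Finset α) (hg : ∀ S ⊆ T, 1 < #S → g S = 0) :
    ∑ S ∈ T.powerset, g S = g ∅ + ∑ j ∈ T, g {j} := by
  induction T using Finset.induction_on with
  | empty => simp
  | insert u T hu ih =>
    rw [sum_powerset_insert hu, ih fun S hS => hg S (hS.trans (subset_insert u T)),
      sum_insert hu, sum_eq_single (a := ∅) (f := fun S => g (insert u S))]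
    · rw [insert_empty_eq, add_assoc, add_comm (∑ j ∈ T, g {j})]
    · intro S hS hne
      rw [mem_powerset] at hS
      refine hg _ (insert_subset_insert u hS) ?_
      rw [card_insert_of_notMem fun h => hu (hS h)]
      have := card_pos.2 (nonempty_iff_ne_empty.2 hne)
      omega
    · intro h; simp at h

theorem IsQuadratic.apply_indVec_insert {n : ℕ} {f : (Fin n → ZMod 2) → ZMod 2}
    (hf : IsQuadratic f) {v : Fin n} {T : Finset (Fin n)} (hv : v ∉ T) :
    f (indVec (insert v T)) =
      f (indVec T) + (anfCoeff f {v} + ∑ j ∈ T, anfCoeff f {v, j}) := by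
  rw [apply_indVec f, apply_indVec f, sum_powerset_insert hv,
    sum_powerset_eq_add_sum_singleton (fun S => anfCoeff f (insert v S))]
  · simp
  · intro S hS hcard
    refine hf _ ?_
    rw [card_insert_of_notMem fun h => hv (hS h)]
    omega

/-- A sign, written as an even power of `I`. -/
theorem neg_one_pow_val_eq (a : ZMod 2) {m : ℤ} (h : (m : ZMod 2) = a) :
    (-1 : ℂ) ^ a.val = Complex.I ^ (2 * m) := by
  subst h
  have h2 : (((m : ZMod 2).val : ℕ) : ℤ) = m % 2 := ZMod.val_intCast m
  rw [← zpow_natCast, h2, ← I_zpow_two, ← zpow_mul]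
  refine I_zpow_congr ?_
  unfold Int.ModEq
  omega

/-- The sign is `i ^ (2f)`: the symmetric matrix doubles the off-diagonal coefficients by itself,
and `anfMatrix` doubles the linear ones explicitly. -/
theorem IsQuadratic.neg_one_pow_apply_indVec {n : ℕ} {f : (Fin n → ZMod 2) → ZMod 2}
    (hf : IsQuadratic f) (T : Finset (Fin n)) :
    (-1 : ℂ) ^ (f (indVec T)).val =
      (-1) ^ (f (indVec ∅)).val * Complex.I ^ quadForm (anfMatrix f) T := by
  have hadd : ∀ a b : ZMod 2, (-1 : ℂ) ^ (a + b).val = (-1) ^ a.val * (-1) ^ b.val := by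
    intro a b
    rw [neg_one_pow_val_eq (a + b) (m := a.val + b.val) (by simp),
      neg_one_pow_val_eq a (m := a.val) (by simp), neg_one_pow_val_eq b (m := b.val) (by simp),
      ← zpow_add₀ Complex.I_ne_zero, mul_add]
  induction T using Finset.induction_on with
  | empty => simp [quadForm]
  | insert v T hv ih =>
    rw [hf.apply_indVec_insert hv, hadd, ih, quadForm_insert (anfMatrix_symm f) hv,
      neg_one_pow_val_eq (anfCoeff f {v} + ∑ j ∈ T, anfCoeff f {v, j})
        (m := (anfCoeff f {v}).val + ∑ j ∈ T, anfMatrix f v j), add_assoc,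
      zpow_add₀ Complex.I_ne_zero (quadForm (anfMatrix f) T), mul_assoc]
    · congr 3
      have : anfMatrix f v v = 2 * ((anfCoeff f {v}).val : ℤ) := if_pos rfl
      rw [this]
      ring
    · push_cast
      congr 1
      · simp
      · refine sum_congr rfl fun j hj => ?_
        have : v ≠ j := fun h => hv (h ▸ hj)
        simp [anfMatrix, this]

/-! ### The entries of the `{I, H, N}` transform as exponential sums -/

theorem indVec_bijective (n : ℕ) :
    Function.Bijective (indVec : Finset (Fin n) → Fin n → ZMod 2) := by
  constructor
  · intro S T h
    ext i
    have := congrFun h i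
    by_cases hS : i ∈ S <;> by_cases hT : i ∈ T <;> simp_all [indVec]
  · intro x
    refine ⟨univ.filter fun i => x i = 1, ?_⟩
    funext i
    have h : ∀ a : ZMod 2, (if a = 1 then 1 else 0) = a := by decide
    simpa [indVec] using h (x i)

/-- The exponent of `I` in the second column of the Hadamard (`u = 1`) or negahadamard (`u = 2`)
matrix, in row `k`. -/
def transExponent (u : Fin 3) (k : ZMod 2) : ℤ :=
  (if u = 2 then 1 else 0) + 2 * (k.val : ℤ)

theorem transIHN_zero (k x : ZMod 2) : transIHN 0 k x = if k = x then 1 else 0 := by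
  simp [transIHN, Matrix.one_apply]

theorem transIHN_of_ne_zero {u : Fin 3} (hu : u ≠ 0) (k x : ZMod 2) :
    transIHN u k x =
      ((Real.sqrt 2 : ℝ) : ℂ)⁻¹ * if x = 1 then Complex.I ^ transExponent u k else 1 := by
  have h2 := I_zpow_two
  have h3 := I_zpow_three
  have h01 : ∀ a : ZMod 2, a = 0 ∨ a = 1 := by decide
  have hval : (1 : ZMod 2).val = 1 := rfl
  fin_cases u
  · exact absurd rfl hu
  · rcases h01 k with rfl | rfl <;> rcases h01 x with rfl | rfl <;>
      simp [transIHN, hadamard, transExponent, h2, hval] <;> rfl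
  · rcases h01 k with rfl | rfl <;> rcases h01 x with rfl | rfl <;>
      simp [transIHN, negahadamard, transExponent, h3, hval] <;> rfl

/-- With `T` the coordinates frozen at one, the cross terms are linear in `S` and can be absorbed
into the diagonal; this is the second summand of `transDiag`. -/
theorem quadForm_union_of_disjoint {V : Type*} [DecidableEq V] {A : V → V → ℤ}
    (hA : ∀ i j, A i j = A j i) {S T : Finset V} (h : Disjoint S T) :
    quadForm A (S ∪ T) = quadForm A S + quadForm A T + ∑ i ∈ S, 2 * ∑ j ∈ T, A i j := by
  have hc : ∑ i ∈ T, ∑ j ∈ S, A i j = ∑ i ∈ S, ∑ j ∈ T, A i j := by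
    rw [sum_comm]
    exact sum_congr rfl fun i _ => sum_congr rfl fun j _ => hA j i
  simp only [quadForm, sum_union h, sum_add_distrib, hc, ← mul_sum]
  ring

theorem quadForm_add_diag {V : Type*} [DecidableEq V] (A : V → V → ℤ) (d : V → ℤ)
    (T : Finset V) :
    quadForm (fun i j => A i j + if i = j then d i else 0) T = quadForm A T + ∑ i ∈ T, d i := by
  simp only [quadForm, sum_add_distrib]
  congr 1
  exact sum_congr rfl fun i hi => by simp [hi]

theorem Realizes.add_diag {V : Type*} [DecidableEq V] {A : V → V → ℤ} {G : SimpleGraph V}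
    (hA : Realizes A G) (d : V → ℤ) :
    Realizes (fun i j => A i j + if i = j then d i else 0) G := by
  refine ⟨fun i j => ?_, fun i j hij => ?_⟩
  · by_cases h : i = j
    · rw [h]
    · simp only [if_neg h, if_neg (Ne.symm h), hA.symm i j]
  · simp only [if_neg hij, add_zero, hA.odd_iff i j hij]

/-- The positions at which the transform is not the identity. -/
def transSupport {n : ℕ} (u : Fin n → Fin 3) : Finset (Fin n) :=
  univ.filter fun i => u i ≠ 0

/-- The positions at which the transform is the identity and `k` is one. -/
def fixedOnes {n : ℕ} (u : Fin n → Fin 3) (k : Fin n → ZMod 2) : Finset (Fin n) :=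
  univ.filter fun i => u i = 0 ∧ k i = 1

/-- The diagonal change of `anfMatrix f` caused by the transform `u` and the index `k`. -/
def transDiag {n : ℕ} (f : (Fin n → ZMod 2) → ZMod 2) (u : Fin n → Fin 3)
    (k : Fin n → ZMod 2) (i : Fin n) : ℤ :=
  transExponent (u i) (k i) + 2 * ∑ j ∈ fixedOnes u k, anfMatrix f i j

theorem disjoint_fixedOnes {n : ℕ} {u : Fin n → Fin 3} (k : Fin n → ZMod 2)
    {T : Finset (Fin n)} (hT : T ⊆ transSupport u) : Disjoint T (fixedOnes u k) := by
  rw [disjoint_left]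
  intro i hi hi'
  exact (mem_filter.1 (hT hi)).2 (mem_filter.1 hi').2.1

/-- Each identity factor forces `x i = k i`, so only the vectors supported on `T ∪ fixedOnes u k`
with `T ⊆ transSupport u` survive. -/
theorem sum_tensor_transIHN {n : ℕ} (u : Fin n → Fin 3) (k : Fin n → ZMod 2)
    (s : (Fin n → ZMod 2) → ℂ) :
    (tensor fun i => transIHN (u i)).mulVec s k =
      ∑ T ∈ (transSupport u).powerset, ((Real.sqrt 2 : ℝ) : ℂ)⁻¹ ^ #(transSupport u) *
        Complex.I ^ (∑ i ∈ T, transExponent (u i) (k i)) * s (indVec (T ∪ fixedOnes u k)) := by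
  have hinj : Set.InjOn (fun T : Finset (Fin n) => T ∪ fixedOnes u k)
      (transSupport u).powerset := by
    intro S hS T hT h
    have hS' := disjoint_fixedOnes k (mem_powerset.1 hS)
    have hT' := disjoint_fixedOnes k (mem_powerset.1 hT)
    have h' : S ∪ fixedOnes u k = T ∪ fixedOnes u k := h
    rw [← union_sdiff_cancel_right hS', h', union_sdiff_cancel_right hT']
  calc (tensor fun i => transIHN (u i)).mulVec s k
      = ∑ T : Finset (Fin n), (∏ i, transIHN (u i) (k i) (indVec T i)) * s (indVec T) :=
        ((indVec_bijective n).sum_comp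
          fun x => (∏ i, transIHN (u i) (k i) (x i)) * s x).symm
    _ = ∑ T ∈ (transSupport u).powerset.image (· ∪ fixedOnes u k),
          (∏ i, transIHN (u i) (k i) (indVec T i)) * s (indVec T) := by
        refine (sum_subset (subset_univ _) fun T _ hT => ?_).symm
        have hex : ∃ i, u i = 0 ∧ k i ≠ indVec T i := by
          by_contra hcon
          push Not at hcon
          refine hT (mem_image.2 ⟨T.filter fun i => u i ≠ 0, ?_, ?_⟩)
          · rw [mem_powerset]
            exact fun i hi => mem_filter.2 ⟨mem_univ i, (mem_filter.1 hi).2⟩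
          · ext i
            have := hcon i
            by_cases hi : u i = 0 <;> by_cases hiT : i ∈ T <;>
              simp_all [fixedOnes, indVec]
        obtain ⟨i, hi, hne⟩ := hex
        rw [prod_eq_zero (mem_univ i) (by rw [hi, transIHN_zero, if_neg hne]), zero_mul]
    _ = _ := by
        rw [sum_image hinj]
        refine sum_congr rfl fun T hT => ?_
        congr 1
        rw [mem_powerset] at hT
        have hentry : ∀ i, transIHN (u i) (k i) (indVec (T ∪ fixedOnes u k) i) =
            (if i ∈ transSupport u then ((Real.sqrt 2 : ℝ) : ℂ)⁻¹ else 1) *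
              if i ∈ T then Complex.I ^ transExponent (u i) (k i) else 1 := by
          intro i
          by_cases hi : u i = 0
          · have hiT : i ∉ T := fun h => (mem_filter.1 (hT h)).2 hi
            have hk : ∀ a : ZMod 2, a = if a = 1 then 1 else 0 := by decide
            rw [hi, transIHN_zero, if_pos]
            · simp [transSupport, hi, hiT]
            · simpa [indVec, fixedOnes, hi, hiT] using hk (k i)
          · rw [transIHN_of_ne_zero hi]
            simp [transSupport, hi, indVec, fixedOnes]
        rw [prod_congr rfl fun i _ => hentry i, prod_mul_distrib, I_zpow_sum]
        congr 1
        · rw [prod_ite_mem, univ_inter, prod_const]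
        · rw [prod_ite_mem, univ_inter]

theorem IsQuadratic.normSq_transform {n : ℕ} {f : (Fin n → ZMod 2) → ZMod 2}
    (hf : IsQuadratic f) (u : Fin n → Fin 3) (k : Fin n → ZMod 2) :
    2 ^ n * ‖(tensor fun i => transIHN (u i)).mulVec (stateVec f) k‖ ^ 2 =
      power (fun i j => anfMatrix f i j + if i = j then transDiag f u k i else 0)
        (transSupport u) := by
  have h : (tensor fun i => transIHN (u i)).mulVec (stateVec f) k =
      ((Real.sqrt 2 : ℝ) : ℂ)⁻¹ ^ #(transSupport u) * (((Real.sqrt 2 : ℝ) : ℂ) ^ n)⁻¹ *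
        (-1) ^ (f (indVec ∅)).val * Complex.I ^ quadForm (anfMatrix f) (fixedOnes u k) *
        expSum (fun i j => anfMatrix f i j + if i = j then transDiag f u k i else 0)
          (transSupport u) := by
    rw [sum_tensor_transIHN, expSum, mul_sum]
    refine sum_congr rfl fun T hT => ?_
    rw [stateVec, hf.neg_one_pow_apply_indVec, quadForm_add_diag,
      quadForm_union_of_disjoint (anfMatrix_symm f) (disjoint_fixedOnes k (mem_powerset.1 hT))]
    simp only [transDiag, sum_add_distrib, zpow_add₀ Complex.I_ne_zero]
    ring
  have hs : ‖((Real.sqrt 2 : ℝ) : ℂ)‖ ^ 2 = 2 := by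
    rw [Complex.norm_real, Real.norm_eq_abs, sq_abs, Real.sq_sqrt zero_le_two]
  rw [h, power]
  simp only [norm_mul, norm_pow, norm_inv, norm_neg, norm_one, one_pow, mul_one, norm_I_zpow,
    mul_pow, inv_pow]
  rw [← pow_mul, ← pow_mul, mul_comm _ 2, mul_comm n 2, pow_mul, pow_mul, hs]
  field_simp

theorem IsQuadratic.exists_transform_of_attains {n : ℕ} {f : (Fin n → ZMod 2) → ZMod 2}
    (hf : IsQuadratic f) {r : ℝ} (h : Attains (graphOf f) r) :
    ∃ (u : Fin n → Fin 3) (k : Fin n → ZMod 2),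
      2 ^ n * ‖(tensor fun i => transIHN (u i)).mulVec (stateVec f) k‖ ^ 2 = r := by
  obtain ⟨A, R, hA, rfl⟩ := h
  -- `c` is the required diagonal change modulo 4. Its parity chooses `N` or `H`, and `c / 2` modulo
  -- 2 chooses the row. Setting `k = 0` off `R` leaves no frozen ones.
  let c : Fin n → ℤ := fun i => A i i - anfMatrix f i i
  let u : Fin n → Fin 3 := fun i => if i ∈ R then if Odd (c i) then 2 else 1 else 0
  let k : Fin n → ZMod 2 := fun i => if i ∈ R then ((c i / 2 : ℤ) : ZMod 2) else 0
  have hsupp : transSupport u = R := by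
    ext i
    by_cases hi : i ∈ R
    · by_cases hc : Odd (c i) <;> simp [transSupport, u, hi, hc]
    · simp [transSupport, u, hi]
  have hfix : fixedOnes u k = ∅ := by
    refine filter_eq_empty_iff.2 fun i _ hi => ?_
    by_cases hiR : i ∈ R
    · exact (mem_filter.1 (hsupp.symm ▸ hiR : i ∈ transSupport u)).2 hi.1
    · simp [k, hiR] at hi
  refine ⟨u, k, ?_⟩
  rw [hf.normSq_transform, hsupp]
  have hB := (realizes_anfMatrix f).add_diag (transDiag f u k)
  refine power_congr hB.symm hA.symm (fun i hi => ?_) fun i _ j _ hij => ?_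
  · have hval : (((c i / 2 : ℤ) : ZMod 2).val : ℤ) = (c i / 2) % 2 := ZMod.val_intCast _
    have hd : transDiag f u k i ≡ c i [ZMOD 4] := by
      rw [transDiag, hfix, sum_empty, mul_zero, add_zero, transExponent]
      simp only [u, k, if_pos hi, hval]
      by_cases hc : Odd (c i)
      · rw [if_pos hc, if_pos rfl]
        rw [Int.odd_iff] at hc
        unfold Int.ModEq; omega
      · rw [if_neg hc, if_neg (by decide)]
        rw [Int.not_odd_iff_even, Int.even_iff] at hc
        unfold Int.ModEq; omega
    rw [if_pos rfl]
    calc anfMatrix f i i + transDiag f u k i ≡ anfMatrix f i i + c i [ZMOD 4] := hd.add_left _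
      _ = A i i := by simp [c]
  · have h1 := (hB.odd_iff i j hij).trans (hA.odd_iff i j hij).symm
    simp only [Int.odd_iff] at h1
    unfold Int.ModEq
    omega

/-! ### The maximum over the orbit, and the conclusion. -/

/-- Needed because `sSup` of an unbounded set of naturals is 0 by convention. -/
theorem bddAbove_indepNum_lcOrbit {n : ℕ} (G : SimpleGraph (Fin n)) :
    BddAbove {a | ∃ K ∈ lcOrbit G, a = K.indepNum} := by
  refine ⟨n, ?_⟩
  rintro a ⟨K, _, rfl⟩
  obtain ⟨s, hs⟩ := K.exists_isNIndepSet_indepNum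
  rw [← hs.card_eq]
  simpa using card_le_univ s

theorem exists_indepNum_eq_lam {n : ℕ} (G : SimpleGraph (Fin n)) :
    ∃ K ∈ lcOrbit G, K.indepNum = lam G := by
  obtain ⟨K, hK, h⟩ := Nat.sSup_mem (s := {a | ∃ K ∈ lcOrbit G, a = K.indepNum})
    ⟨_, G, Relation.ReflTransGen.refl, rfl⟩ (bddAbove_indepNum_lcOrbit G)
  exact ⟨K, hK, h.symm⟩

end BoolPAR

theorem mainTheorem1 {n : ℕ} (G : SimpleGraph (Fin n)) (f : (Fin n → ZMod 2) → ZMod 2)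
    (hf : BoolPAR.IsQuadratic f) (hG : BoolPAR.graphOf f ∈ BoolPAR.lcOrbit G) :
    BoolPAR.parIHN f = 2 ^ BoolPAR.lam G := by
  refine le_antisymm ?_ ?_
  · rw [BoolPAR.parIHN, BoolPAR.PAR]
    obtain ⟨⟨u, k⟩, -, h⟩ := Finset.exists_mem_eq_sup'
      (Finset.univ_nonempty (α := (Fin n → Fin 3) × (Fin n → ZMod 2)))
      fun p => ‖(BoolPAR.tensor (fun i => BoolPAR.transIHN (p.1 i))).mulVec
        (BoolPAR.stateVec f) p.2‖ ^ 2
    rw [h, hf.normSq_transform]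
    obtain ⟨K, hK, hle⟩ := BoolPAR.exists_power_le_of_realizes (BoolPAR.transSupport u) _ _
      ((BoolPAR.realizes_anfMatrix f).add_diag (BoolPAR.transDiag f u k))
    exact hle.trans (pow_le_pow_right₀ one_le_two
      (le_csSup (BoolPAR.bddAbove_indepNum_lcOrbit G) ⟨K, BoolPAR.lcOrbit_trans hG hK, rfl⟩))
  · obtain ⟨K, hK, hlam⟩ := BoolPAR.exists_indepNum_eq_lam G
    obtain ⟨s, hs⟩ := K.exists_isNIndepSet_indepNum
    have hKs := BoolPAR.attains_of_isIndepSet hs.isIndepSet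
    -- The value attained by the optimal graph `K` is carried to `G` and then to `graphOf f`.
    rw [hs.card_eq, hlam, BoolPAR.attains_iff_of_mem_lcOrbit hK,
      ← BoolPAR.attains_iff_of_mem_lcOrbit hG] at hKs
    obtain ⟨u, k, h⟩ := hf.exists_transform_of_attains hKs
    rw [← h, BoolPAR.parIHN, BoolPAR.PAR]
    refine mul_le_mul_of_nonneg_left ?_ (by positivity)
    exact Finset.le_sup' (fun p : (Fin n → Fin 3) × (Fin n → ZMod 2) =>
      ‖(BoolPAR.tensor (fun i => BoolPAR.transIHN (p.1 i))).mulVec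
        (BoolPAR.stateVec f) p.2‖ ^ 2) (Finset.mem_univ (u, k))
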